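/- Let $p,q$ be real numbers with $2\le p<q$. Then there exists a function $f$, analytic in the open unit disc $\mathbb{D}$ with Taylor expansion $f(z)=\sum_{n\ge0}\widehat f(n)z^n$, $z\in\mathbb{D}$, such that (a) $f$ is strongly annular, that is, $\displaystyle\limsup_{r\to1^-}\ \min_{|z|=r}|f(z)|=\infty$; (b) $\widehat f\in\ell^q$, that is, $\sum_{n\ge0}|\widehat f(n)|^q<\infty$; (c) $\widehat f\notin\widetilde\ell^{\,p}$, where $\widetilde\ell^{\,p}$ is the set of complex sequences $(a_n)_{n\ge0}$ with $\sum_{k\ge0}\min(|a_{2k}|^p,|a_{2k+1}|^p)<\infty$; in other words, $\sum_{k\ge0}\min\bigl(|\widehat f(2k)|^p,|\widehat f(2k+1)|^p\bigr)=\infty$. -/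

import Mathlib

open scoped ENNReal Topology

noncomputable section

/-- A function `f`, analytic in the open unit disc, is strongly annular if
`limsup_{r → 1⁻} min_{|z| = r} |f z| = ∞`. The minimum over the (compact, nonempty) circle is
written as an infimum in `[0, ∞]`, and the upper limit is taken in `[0, ∞]` too. -/
def StronglyAnnular (f : ℂ → ℂ) : Prop :=
  AnalyticOnNhd ℂ f (Metric.ball 0 1) ∧
    Filter.limsup (fun r : ℝ => ⨅ z ∈ Metric.sphere (0 : ℂ) r, ‖f z‖ₑ) (𝓝[<] (1 : ℝ)) = ∞

/-- The `n`-th Taylor coefficient of `f` at the origin. -/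
def taylorCoeff (f : ℂ → ℂ) (n : ℕ) : ℂ :=
  iteratedDeriv n f 0 / (n.factorial : ℂ)

/-- The set of complex sequences `a` with `∑ k, min (|a (2k)| ^ p) (|a (2k+1)| ^ p) < ∞`. -/
def tildeLp (p : ℝ) : Set (ℕ → ℂ) :=
  {a | Summable fun k : ℕ => min (‖a (2 * k)‖ ^ p) (‖a (2 * k + 1)‖ ^ p)}

end

open Finset Filter

/-! For `q > 2` a polynomial can be large on the whole unit circle while its coefficients are small
in `ℓ^q`. A truncated Blaschke factor has modulus near 1 there, and its `ℓ^q` sum is below 1.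
Passing from `P(z)`, `Q(z)` to `P(z) Q(z ^ N)` multiplies both the `ℓ^q` sums and the lower bounds,
so iterating and rescaling gives `exists_sum_rpow_le_and_le_norm`.

In `exists_block` such a polynomial follows a run of equal coefficients, small in `ℓ^q` but with
`p`-th powers summing to 1 over the pairs. Infinitely many blocks are concatenated, with summable
`ℓ^q` costs. After each one a radius near 1 is fixed on which the partial sum is large, and zeros
are appended until the remaining tail is at most 1 there. -/

/-! ### Products `P(z) Q(z ^ N)` -/

theorem sum_range_mul_eq_sum_sum {E : Type*} [AddCommMonoid E] (N M : ℕ) (F : ℕ → E) :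
    ∑ n ∈ range (N * M), F n = ∑ j ∈ range M, ∑ i ∈ range N, F (N * j + i) := by
  induction M with
  | zero => simp
  | succ M ih => rw [Nat.mul_succ, sum_range_add, ih, sum_range_succ]

/-- Coefficients of `P(z) Q(z ^ N)`, for `P` of degree less than `N`. -/
def tensorCoeff (N : ℕ) (a b : ℕ → ℂ) (n : ℕ) : ℂ := a (n % N) * b (n / N)

theorem tensorCoeff_mul_add {N i : ℕ} (a b : ℕ → ℂ) (j : ℕ) (hi : i < N) :
    tensorCoeff N a b (N * j + i) = a i * b j := by
  have h0 : 0 < N := by omega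
  simp [tensorCoeff, Nat.mul_add_div h0, Nat.mod_eq_of_lt hi,
    Nat.div_eq_of_lt hi]

theorem sum_tensorCoeff_mul_pow (N M : ℕ) (a b : ℕ → ℂ) (z : ℂ) :
    ∑ n ∈ range (N * M), tensorCoeff N a b n * z ^ n =
      (∑ i ∈ range N, a i * z ^ i) * ∑ j ∈ range M, b j * (z ^ N) ^ j := by
  rw [sum_range_mul_eq_sum_sum, mul_sum]
  refine sum_congr rfl fun j _ => ?_
  rw [sum_mul]
  refine sum_congr rfl fun i hi => ?_
  rw [tensorCoeff_mul_add a b j (mem_range.1 hi), pow_add, pow_mul]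
  ring

theorem sum_norm_tensorCoeff_rpow (N M : ℕ) (a b : ℕ → ℂ) (q : ℝ) :
    ∑ n ∈ range (N * M), ‖tensorCoeff N a b n‖ ^ q =
      (∑ i ∈ range N, ‖a i‖ ^ q) * ∑ j ∈ range M, ‖b j‖ ^ q := by
  rw [sum_range_mul_eq_sum_sum, mul_sum]
  refine sum_congr rfl fun j _ => ?_
  rw [sum_mul]
  refine sum_congr rfl fun i hi => ?_
  rw [tensorCoeff_mul_add a b j (mem_range.1 hi), norm_mul,
    Real.mul_rpow (norm_nonneg _) (norm_nonneg _)]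

/-! ### Flat polynomials from a Blaschke factor -/

/-- Coefficients of `(z - 1/2) ∑ j ≤ m, (z/2) ^ j`, a truncation of the Blaschke factor with
zero `1/2`. -/
noncomputable def blaschkeCoeff (m n : ℕ) : ℂ :=
  if n = 0 then -1 / 2 else if n ≤ m then 3 / 4 * (1 / 2) ^ (n - 1) else (1 / 2) ^ m

theorem sum_blaschkeCoeff {E : Type*} [AddCommMonoid E] (m : ℕ) (F : ℕ → ℂ → E) :
    ∑ n ∈ range (m + 2), F n (blaschkeCoeff m n) =
      F 0 (-1 / 2) + ∑ n ∈ range m, F (n + 1) (3 / 4 * (1 / 2) ^ n) +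
        F (m + 1) ((1 / 2) ^ m) := by
  rw [sum_range_succ, sum_range_succ', add_comm (∑ k ∈ range m, _)]
  congr 1
  · congr 1
    refine sum_congr rfl fun n hn => ?_
    have : n + 1 ≤ m := mem_range.1 hn
    simp [blaschkeCoeff, this]
  · simp [blaschkeCoeff]

theorem sum_blaschkeCoeff_mul_pow (m : ℕ) (z : ℂ) :
    (1 - z / 2) * ∑ n ∈ range (m + 2), blaschkeCoeff m n * z ^ n =
      (z - 1 / 2) * (1 - (z / 2) ^ (m + 1)) := by
  rw [sum_blaschkeCoeff m fun n c => c * z ^ n]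
  induction m with
  | zero => simp; ring
  | succ m ih =>
    rw [sum_range_succ]
    have h : ∀ A B C D T : ℂ, (1 - z / 2) * (A + B + C) = T →
        (1 - z / 2) * (A + (B + D) + C) = T + (1 - z / 2) * D := by
      intro A B C D T h; rw [← h]; ring
    have e : ∀ A B D C C' : ℂ, A + (B + D) + C' = A + B + C + (D + C' - C) := by intros; ring
    rw [e _ _ _ ((1 / 2) ^ m * z ^ (m + 1)), mul_add, ih]
    simp only [div_pow, pow_succ]
    field_simp
    ring

/-- The Blaschke factor is unimodular on the circle, which leaves only the truncation factor `1 - (z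
/ 2) ^ (m + 1)`. -/
theorem one_sub_le_norm_sum_blaschkeCoeff (m : ℕ) {z : ℂ} (hz : ‖z‖ = 1) :
    1 - (1 / 2 : ℝ) ^ (m + 1) ≤ ‖∑ n ∈ range (m + 2), blaschkeCoeff m n * z ^ n‖ := by
  have h := congrArg norm (sum_blaschkeCoeff_mul_pow m z)
  have hsq : z.re ^ 2 + z.im ^ 2 = 1 := by
    have := Complex.sq_norm z
    rw [hz, Complex.normSq_apply] at this
    linarith
  have he : ‖1 - z / 2‖ = ‖z - 1 / 2‖ := by
    rw [← sq_eq_sq₀ (norm_nonneg _) (norm_nonneg _), Complex.sq_norm, Complex.sq_norm,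
      Complex.normSq_apply, Complex.normSq_apply]
    simp
    linarith
  have hpos : 0 < ‖1 - z / 2‖ := by
    rw [norm_pos_iff]
    intro h0
    have : z = 2 := by linear_combination -2 * h0
    rw [this] at hz
    norm_num at hz
  rw [norm_mul, norm_mul, ← he] at h
  rw [mul_left_cancel₀ hpos.ne' h]
  refine le_trans ?_ (norm_sub_norm_le _ _)
  simp [hz]

theorem sum_norm_blaschkeCoeff_rpow_le (m : ℕ) {q : ℝ} (hq : 0 < q) :
    ∑ n ∈ range (m + 2), ‖blaschkeCoeff m n‖ ^ q ≤
      (1 / 2 : ℝ) ^ q + (3 / 4) ^ q / (1 - (1 / 2) ^ q) + ((1 / 2) ^ q) ^ m := by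
  have h1 : (1 / 2 : ℝ) ^ q < 1 := Real.rpow_lt_one (by norm_num) (by norm_num) hq
  have h0 : 0 ≤ (1 / 2 : ℝ) ^ q := by positivity
  rw [sum_blaschkeCoeff m fun _ c => ‖c‖ ^ q]
  have hc : ∀ n : ℕ, ((1 / 2 : ℝ) ^ n) ^ q = ((1 / 2 : ℝ) ^ q) ^ n := fun n => by
    rw [← Real.rpow_natCast, ← Real.rpow_natCast, ← Real.rpow_mul (by norm_num),
      ← Real.rpow_mul (by norm_num), mul_comm]
  have hA : ‖(-1 / 2 : ℂ)‖ ^ q = (1 / 2 : ℝ) ^ q := by norm_num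
  have hB : ∀ n : ℕ, ‖(3 / 4 * (1 / 2) ^ n : ℂ)‖ ^ q = (3 / 4 : ℝ) ^ q * ((1 / 2) ^ q) ^ n := by
    intro n
    rw [← hc, ← Real.mul_rpow (by norm_num) (by positivity)]
    norm_num
  have hC : ‖((1 / 2) ^ m : ℂ)‖ ^ q = ((1 / 2 : ℝ) ^ q) ^ m := by
    rw [← hc]; norm_num
  rw [hA, hC, sum_congr rfl fun n _ => hB n, ← mul_sum]
  gcongr
  rw [div_eq_mul_inv ((3 / 4 : ℝ) ^ q), ← tsum_geometric_of_lt_one h0 h1]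
  gcongr
  exact (summable_geometric_of_lt_one h0 h1).sum_le_tsum _ fun _ _ => by positivity

/-- At `q = 2` the left side is exactly 1 (Parseval), and it decreases strictly in `q`. -/
theorem blaschke_rpow_sum_lt_one {q : ℝ} (hq : 2 < q) :
    (1 / 2 : ℝ) ^ q + (3 / 4) ^ q / (1 - (1 / 2) ^ q) < 1 := by
  have h1 : (1 / 2 : ℝ) ^ q < 1 / 4 := by
    have := Real.rpow_lt_rpow_of_exponent_gt (x := 1 / 2) (by norm_num) (by norm_num) hq
    norm_num at this ⊢; exact this
  have h2 : (3 / 4 : ℝ) ^ q < 9 / 16 := by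
    have := Real.rpow_lt_rpow_of_exponent_gt (x := 3 / 4) (by norm_num) (by norm_num) hq
    norm_num at this ⊢; exact this
  have h3 : (3 / 4 : ℝ) ^ q / (1 - (1 / 2) ^ q) < 3 / 4 := by
    rw [div_lt_iff₀ (by linarith)]
    linarith
  linarith

/-- There are polynomials that exceed `1` on the unit circle with `ℓ^q` norm less than `1`. -/
theorem exists_sum_rpow_lt_one_and_one_le_norm {q : ℝ} (hq : 2 < q) :
    ∃ (K : ℕ) (a : ℕ → ℂ), ∑ n ∈ range (2 * K), ‖a n‖ ^ q < 1 ∧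
      ∀ z : ℂ, ‖z‖ = 1 → 1 ≤ ‖∑ n ∈ range (2 * K), a n * z ^ n‖ := by
  have hq0 : 0 < q := by linarith
  have h1 : (1 / 2 : ℝ) ^ q < 1 := Real.rpow_lt_one (by norm_num) (by norm_num) hq0
  -- Even `m` makes the number `m + 2` of coefficients even, so that blocks never split a pair `(2k,
  -- 2k+1)`.
  have hdbl : Tendsto (fun t : ℕ => 2 * t) atTop atTop :=
    tendsto_id.const_mul_atTop' (by norm_num)
  have hL : Tendsto (fun t : ℕ => (1 / 2 : ℝ) ^ q + (3 / 4) ^ q / (1 - (1 / 2) ^ q) +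
      ((1 / 2) ^ q) ^ (2 * t)) atTop
      (𝓝 ((1 / 2 : ℝ) ^ q + (3 / 4) ^ q / (1 - (1 / 2) ^ q) + 0)) :=
    ((tendsto_pow_atTop_nhds_zero_of_lt_one (by positivity) h1).comp hdbl).const_add _
  have hR : Tendsto (fun t : ℕ => (1 - (1 / 2 : ℝ) ^ (2 * t + 1)) ^ q) atTop
      (𝓝 ((1 - 0 : ℝ) ^ q)) := by
    refine Tendsto.rpow_const (Tendsto.const_sub _ ?_) (Or.inr hq0.le)
    exact (tendsto_pow_atTop_nhds_zero_of_lt_one (by norm_num) (by norm_num)).comp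
      ((tendsto_add_atTop_nat 1).comp hdbl)
  have hlt : (1 / 2 : ℝ) ^ q + (3 / 4) ^ q / (1 - (1 / 2) ^ q) + 0 < (1 - 0 : ℝ) ^ q := by
    simpa using blaschke_rpow_sum_lt_one hq
  obtain ⟨t, ht⟩ := (hL.eventually_lt hR hlt).exists
  set μ : ℝ := 1 - (1 / 2 : ℝ) ^ (2 * t + 1) with hμ
  have hμ0 : 0 < μ := sub_pos.2 (pow_lt_one₀ (by norm_num) (by norm_num) (by omega))
  refine ⟨t + 1, fun n => (μ : ℂ)⁻¹ * blaschkeCoeff (2 * t) n, ?_, fun z hz => ?_⟩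
  · have hs := (sum_norm_blaschkeCoeff_rpow_le (2 * t) hq0).trans_lt ht
    have e : ∀ n, ‖(μ : ℂ)⁻¹ * blaschkeCoeff (2 * t) n‖ ^ q =
        (μ ^ q)⁻¹ * ‖blaschkeCoeff (2 * t) n‖ ^ q := fun n => by
      rw [norm_mul, Real.mul_rpow (norm_nonneg _) (norm_nonneg _), norm_inv, Complex.norm_real,
        Real.norm_of_nonneg hμ0.le, Real.inv_rpow hμ0.le]
    simp only [e]
    rw [← mul_sum, inv_mul_lt_iff₀ (by positivity), mul_one]
    exact hs
  · simp only [mul_assoc]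
    rw [← mul_sum, norm_mul, norm_inv, Complex.norm_real, Real.norm_of_nonneg hμ0.le,
      le_inv_mul_iff₀ hμ0, mul_one]
    exact one_sub_le_norm_sum_blaschkeCoeff (2 * t) hz

/-- For `q > 2` there are polynomials with small `ℓ^q` norm that are large on the unit circle. -/
theorem exists_sum_rpow_le_and_le_norm {q ε : ℝ} (hq : 2 < q) (hε : 0 < ε) (S : ℝ) :
    ∃ (K : ℕ) (a : ℕ → ℂ), ∑ n ∈ range (2 * K), ‖a n‖ ^ q ≤ ε ∧
      ∀ z : ℂ, ‖z‖ = 1 → S ≤ ‖∑ n ∈ range (2 * K), a n * z ^ n‖ := by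
  obtain ⟨K₀, a₀, hs, hm⟩ := exists_sum_rpow_lt_one_and_one_le_norm hq
  set s := ∑ n ∈ range (2 * K₀), ‖a₀ n‖ ^ q
  have hs0 : 0 ≤ s := sum_nonneg fun _ _ => by positivity
  have hpow : ∀ m : ℕ, ∃ (K : ℕ) (a : ℕ → ℂ), ∑ n ∈ range (2 * K), ‖a n‖ ^ q = s ^ (m + 1) ∧
      ∀ z : ℂ, ‖z‖ = 1 → 1 ≤ ‖∑ n ∈ range (2 * K), a n * z ^ n‖ := by
    intro m
    induction m with
    | zero => exact ⟨K₀, a₀, by simp [s], hm⟩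
    | succ m ih =>
      obtain ⟨K, a, ha, ha'⟩ := ih
      refine ⟨K₀ * (2 * K), tensorCoeff (2 * K₀) a₀ a, ?_, fun z hz => ?_⟩
      · rw [← mul_assoc, sum_norm_tensorCoeff_rpow, ha, pow_succ' s (m + 1)]
      · rw [← mul_assoc, sum_tensorCoeff_mul_pow, norm_mul]
        exact one_le_mul_of_one_le_of_one_le (hm z hz) (ha' _ (by simp [hz]))
  have hlim : Tendsto (fun m : ℕ => |S| ^ q * s ^ (m + 1)) atTop (𝓝 (|S| ^ q * 0)) :=
    ((tendsto_pow_atTop_nhds_zero_of_lt_one hs0 hs).comp (tendsto_add_atTop_nat 1)).const_mul _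
  rw [mul_zero] at hlim
  obtain ⟨m, hmε⟩ := (hlim.eventually_le_const hε).exists
  obtain ⟨K, a, ha, ha'⟩ := hpow m
  refine ⟨K, fun n => S * a n, ?_, fun z hz => ?_⟩
  · simp only [norm_mul, Complex.norm_real, Real.norm_eq_abs,
      Real.mul_rpow (abs_nonneg S) (norm_nonneg _)]
    rwa [← mul_sum, ha]
  · simp only [mul_assoc]
    rw [← mul_sum, norm_mul, Complex.norm_real, Real.norm_eq_abs]
    exact (le_abs_self S).trans (le_mul_of_one_le_right (abs_nonneg S) (ha' z hz))

/-! ### Concatenation and the building block -/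

/-- The first `N` terms of `a`, followed by `b`. -/
def appendCoeff (N : ℕ) (a b : ℕ → ℂ) (n : ℕ) : ℂ := if n < N then a n else b (n - N)

theorem appendCoeff_of_lt {N n : ℕ} (a b : ℕ → ℂ) (h : n < N) : appendCoeff N a b n = a n :=
  if_pos h

theorem appendCoeff_add (N n : ℕ) (a b : ℕ → ℂ) : appendCoeff N a b (N + n) = b n := by
  simp [appendCoeff]

theorem sum_appendCoeff {E : Type*} [AddCommMonoid E] (N M : ℕ) (a b : ℕ → ℂ) (F : ℕ → ℂ → E) :
    ∑ n ∈ range (N + M), F n (appendCoeff N a b n) =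
      ∑ n ∈ range N, F n (a n) + ∑ n ∈ range M, F (N + n) (b n) := by
  rw [sum_range_add]
  congr 1
  · exact sum_congr rfl fun n hn => by rw [appendCoeff_of_lt a b (mem_range.1 hn)]
  · exact sum_congr rfl fun n _ => by rw [appendCoeff_add]

theorem sum_appendCoeff_mul_pow (N M : ℕ) (a b : ℕ → ℂ) (z : ℂ) :
    ∑ n ∈ range (N + M), appendCoeff N a b n * z ^ n =
      ∑ n ∈ range N, a n * z ^ n + z ^ N * ∑ n ∈ range M, b n * z ^ n := by
  rw [sum_appendCoeff N M a b fun n c => c * z ^ n, mul_sum]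
  congr 1
  exact sum_congr rfl fun n _ => by ring

theorem le_norm_sum_appendCoeff {N M : ℕ} {a b : ℕ → ℂ} {z : ℂ} {S : ℝ} (hz : ‖z‖ = 1)
    (h : S + ∑ n ∈ range N, ‖a n‖ ≤ ‖∑ n ∈ range M, b n * z ^ n‖) :
    S ≤ ‖∑ n ∈ range (N + M), appendCoeff N a b n * z ^ n‖ := by
  rw [sum_appendCoeff_mul_pow, add_comm]
  refine le_trans ?_ (norm_sub_le_norm_add _ _)
  have h1 : ‖∑ n ∈ range N, a n * z ^ n‖ ≤ ∑ n ∈ range N, ‖a n‖ :=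
    (norm_sum_le _ _).trans_eq (sum_congr rfl fun n _ => by simp [hz])
  rw [norm_mul, norm_pow, hz, one_pow, one_mul]
  linarith

/-- Short of an `ℓ^q` norm bound, a constant sequence can have large `ℓ^p` norm if `p < q`. -/
theorem exists_const_rpow {p q ε : ℝ} (hp : 0 < p) (hpq : p < q) (hε : 0 < ε) :
    ∃ (m : ℕ) (c : ℝ), 0 ≤ c ∧ m * c ^ p = 1 ∧ m * c ^ q ≤ ε := by
  have hlim : Tendsto (fun m : ℕ => (m : ℝ) ^ (-(q / p - 1))) atTop (𝓝 0) :=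
    (tendsto_rpow_neg_atTop (sub_pos.2 ((one_lt_div hp).2 hpq))).comp tendsto_natCast_atTop_atTop
  obtain ⟨m, hm, hm0⟩ := ((hlim.eventually_le_const hε).and (eventually_gt_atTop 0)).exists
  have hm0' : (0 : ℝ) < m := by exact_mod_cast hm0
  refine ⟨m, (m : ℝ) ^ (-p⁻¹), by positivity, ?_, ?_⟩
  · rw [← Real.rpow_mul hm0'.le, neg_mul, inv_mul_cancel₀ hp.ne', Real.rpow_neg_one,
      mul_inv_cancel₀ hm0'.ne']
  · refine le_trans (le_of_eq ?_) hm
    rw [← Real.rpow_mul hm0'.le, neg_sub, sub_eq_add_neg, Real.rpow_add hm0', Real.rpow_one]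
    congr 2
    rw [div_eq_mul_inv]
    ring

theorem exists_block {p q ε : ℝ} (hp : 2 ≤ p) (hpq : p < q) (hε : 0 < ε) (S : ℝ) :
    ∃ (K : ℕ) (b : ℕ → ℂ), ∑ n ∈ range (2 * K), ‖b n‖ ^ q ≤ ε ∧
      1 ≤ ∑ i ∈ range K, min (‖b (2 * i)‖ ^ p) (‖b (2 * i + 1)‖ ^ p) ∧
      ∀ z : ℂ, ‖z‖ = 1 → S ≤ ‖∑ n ∈ range (2 * K), b n * z ^ n‖ := by
  -- The constant occurs `2 * m` times, costing at most `ε / 2`.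
  obtain ⟨m, c, hc, hcp, hcq⟩ := exists_const_rpow (ε := ε / 4) (by linarith) hpq (by positivity)
  obtain ⟨K, a, ha, ha'⟩ := exists_sum_rpow_le_and_le_norm (hp.trans_lt hpq) (half_pos hε)
    (S + ∑ n ∈ range (2 * m), ‖(fun _ => (c : ℂ)) n‖)
  have hnc : ‖(c : ℂ)‖ = c := by rw [Complex.norm_real, Real.norm_of_nonneg hc]
  refine ⟨m + K, appendCoeff (2 * m) (fun _ => (c : ℂ)) a, ?_, ?_, fun z hz => ?_⟩
  · rw [mul_add, sum_appendCoeff _ _ _ _ fun _ c => ‖c‖ ^ q]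
    simp only [hnc, sum_const, card_range, nsmul_eq_mul]
    push_cast
    linarith
  · rw [sum_range_add]
    refine le_add_of_le_of_nonneg (le_of_eq ?_) (sum_nonneg fun _ _ => by positivity)
    rw [← hcp, ← nsmul_eq_mul, ← card_range m, ← sum_const, card_range]
    refine sum_congr rfl fun i hi => ?_
    have := mem_range.1 hi
    rw [appendCoeff_of_lt _ _ (by omega), appendCoeff_of_lt _ _ (by omega), hnc, min_self]
  · rw [mul_add]
    exact le_norm_sum_appendCoeff hz (ha' z hz)

/-- A strict lower bound on the unit circle persists on nearby circles. -/
theorem exists_radius_forall_lt_norm {F : ℂ → ℂ} (hF : Continuous F) {S δ : ℝ} (hδ : 0 < δ)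
    (h : ∀ z : ℂ, ‖z‖ = 1 → S < ‖F z‖) :
    ∃ r : ℝ, 0 < r ∧ 1 - δ < r ∧ r < 1 ∧ ∀ z : ℂ, ‖z‖ = r → S < ‖F z‖ := by
  have hopen : IsOpen {z | S < ‖F z‖} := isOpen_lt continuous_const hF.norm
  obtain ⟨η, hη, hsub⟩ := (isCompact_sphere (0 : ℂ) 1).exists_thickening_subset_open hopen
    fun z hz => h z (by simpa using hz)
  obtain ⟨r, hr, hr1⟩ := exists_between (show max 0 (max (1 - δ) (1 - η)) < 1 by simp [hδ, hη])
  simp only [max_lt_iff] at hr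
  refine ⟨r, hr.1, hr.2.1, hr1, fun z hz => hsub ?_⟩
  rw [Metric.mem_thickening_iff]
  have hr0 : (r : ℂ) ≠ 0 := by exact_mod_cast hr.1.ne'
  refine ⟨z / r, ?_, ?_⟩
  · simp [hz, abs_of_pos hr.1, hr.1.ne']
  · have e : z - z / r = (z / r) * ((r - 1 : ℝ) : ℂ) := by
      push_cast
      field_simp
    rw [dist_eq_norm, e, norm_mul, norm_div, hz, Complex.norm_real, Complex.norm_real,
      Real.norm_of_nonneg hr.1.le, div_self hr.1.ne', one_mul, Real.norm_eq_abs, abs_sub_comm,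
      abs_of_pos (by linarith)]
    linarith

theorem exists_extension {p q ε δ : ℝ} (hp : 2 ≤ p) (hpq : p < q) (hε : 0 < ε) (hδ : 0 < δ)
    (S : ℝ) (M : ℕ) (a : ℕ → ℂ) :
    ∃ (M' : ℕ) (a' : ℕ → ℂ), M < M' ∧ (∀ n < 2 * M, a' n = a n) ∧
      ∑ n ∈ range (2 * M'), ‖a' n‖ ^ q ≤ ∑ n ∈ range (2 * M), ‖a n‖ ^ q + ε ∧
      ∑ i ∈ range M, min (‖a (2 * i)‖ ^ p) (‖a (2 * i + 1)‖ ^ p) + 1 ≤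
        ∑ i ∈ range M', min (‖a' (2 * i)‖ ^ p) (‖a' (2 * i + 1)‖ ^ p) ∧
      ∃ r : ℝ, 0 < r ∧ 1 - δ < r ∧ r < 1 ∧ r ^ (2 * M') / (1 - r) ≤ 1 ∧
        ∀ z : ℂ, ‖z‖ = r → S ≤ ‖∑ n ∈ range (2 * M'), a' n * z ^ n‖ := by
  obtain ⟨K, b, hb, hbp, hbz⟩ := exists_block hp hpq hε (S + 1 + ∑ n ∈ range (2 * M), ‖a n‖)
  obtain ⟨r, hr0, hrδ, hr1, hr⟩ := exists_radius_forall_lt_norm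
    (F := fun z => ∑ n ∈ range (2 * M + 2 * K), appendCoeff (2 * M) a b n * z ^ n)
    (by fun_prop) hδ
    fun z hz => (lt_add_one S).trans_le (le_norm_sum_appendCoeff hz (hbz z hz))
  have hlim := tendsto_pow_atTop_nhds_zero_of_lt_one hr0.le hr1
  obtain ⟨t, ht⟩ := (hlim.eventually_le_const (sub_pos.2 hr1)).exists
  set a₁ := appendCoeff (2 * M) a b with ha₁
  -- Zero padding, chosen after `r`, pushes all later coefficients to powers negligible at radius
  -- `r`.
  set a' := appendCoeff (2 * (M + K)) a₁ 0 with ha'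
  have hM : M < M + K + (t + 1) := by omega
  have hlt : ∀ n < 2 * M, a' n = a n := fun n hn => by
    rw [ha', appendCoeff_of_lt _ _ (by omega), ha₁, appendCoeff_of_lt _ _ hn]
  refine ⟨M + K + (t + 1), a', hM, hlt, ?_, ?_, r, hr0, hrδ, hr1, ?_, fun z hz => ?_⟩
  · rw [mul_add, ha', sum_appendCoeff _ _ _ _ fun _ c => ‖c‖ ^ q, mul_add, ha₁,
      sum_appendCoeff _ _ _ _ fun _ c => ‖c‖ ^ q]
    have : q ≠ 0 := by linarith
    simpa [Real.zero_rpow this] using hb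
  · rw [sum_range_add, sum_range_add]
    refine le_add_of_le_of_nonneg (add_le_add (le_of_eq ?_) (hbp.trans_eq ?_))
      (sum_nonneg fun _ _ => by positivity)
    · refine sum_congr rfl fun i hi => ?_
      have := mem_range.1 hi
      rw [hlt _ (by omega), hlt _ (by omega)]
    · refine sum_congr rfl fun i hi => ?_
      have := mem_range.1 hi
      rw [ha', appendCoeff_of_lt _ _ (by omega), appendCoeff_of_lt _ _ (by omega), ha₁, mul_add,
        appendCoeff_add, add_assoc, appendCoeff_add]
  · rw [div_le_one (sub_pos.2 hr1)]
    exact (pow_le_pow_of_le_one hr0.le hr1.le (by omega)).trans ht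
  · rw [mul_add, ha', sum_appendCoeff_mul_pow]
    simpa [mul_add] using (hr z hz).le

/-! ### The limiting coefficient sequence -/

theorem exists_coeff {p q : ℝ} (hp : 2 ≤ p) (hpq : p < q) :
    ∃ (A : ℕ → ℂ) (M : ℕ → ℕ), (∀ k, k ≤ M k) ∧
      (∀ k, ∑ n ∈ range (2 * M k), ‖A n‖ ^ q ≤ 1) ∧
      (∀ k : ℕ, (k : ℝ) ≤
        ∑ i ∈ range (M k), min (‖A (2 * i)‖ ^ p) (‖A (2 * i + 1)‖ ^ p)) ∧
      ∀ k : ℕ, ∃ r : ℝ, 0 < r ∧ 1 - 1 / ((k : ℝ) + 1) < r ∧ r < 1 ∧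
        r ^ (2 * M (k + 1)) / (1 - r) ≤ 1 ∧
        ∀ z : ℂ, ‖z‖ = r → (k : ℝ) ≤ ‖∑ n ∈ range (2 * M (k + 1)), A n * z ^ n‖ := by
  have hstep (k : ℕ) (s : ℕ × (ℕ → ℂ)) := exists_extension (ε := (1 / 2) ^ (k + 1))
    (δ := 1 / ((k : ℝ) + 1)) hp hpq (by positivity) (by positivity) k s.1 s.2
  choose M' a' hM ha hq hmin hr using hstep
  obtain ⟨s, hs0, hs⟩ : ∃ s : ℕ → ℕ × (ℕ → ℂ), s 0 = (0, 0) ∧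
      ∀ k, s (k + 1) = (M' k (s k), a' k (s k)) :=
    ⟨fun k => Nat.rec (0, 0) (fun k s => (M' k s, a' k s)) k, rfl, fun _ => rfl⟩
  have hmono : StrictMono fun k => (s k).1 := strictMono_nat_of_lt_succ fun k => by
    rw [hs]
    exact hM k (s k)
  have hstab (k j : ℕ) (n : ℕ) (hn : n < 2 * (s k).1) : (s (k + j)).2 n = (s k).2 n := by
    induction j with
    | zero => rfl
    | succ j ih =>
      rw [← ih, ← add_assoc, hs]
      refine ha _ _ n (hn.trans_le ?_)
      have : (s k).1 ≤ (s (k + j)).1 := hmono.monotone (Nat.le_add_right k j)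
      omega
  have hk (k : ℕ) : k ≤ (s k).1 := hmono.id_le k
  obtain ⟨A, hA⟩ : ∃ A : ℕ → ℂ, ∀ k n, n < 2 * (s k).1 → A n = (s k).2 n := by
    -- Coefficient `n` is final by stage `n + 1`, whose length is at least `2 * (n + 1)`.
    refine ⟨fun n => (s (n + 1)).2 n, fun k n hn => ?_⟩
    have := hk (n + 1)
    beta_reduce
    rw [← hstab (n + 1) k n (by omega), ← hstab k (n + 1) n hn, add_comm]
  have hsumq (k : ℕ) :
      ∑ n ∈ range (2 * (s k).1), ‖(s k).2 n‖ ^ q ≤ 1 - (1 / 2 : ℝ) ^ k := by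
    induction k with
    | zero => simp [hs0]
    | succ k ih =>
      rw [hs]
      refine (hq k (s k)).trans ?_
      rw [pow_succ]
      linarith
  have hsummin (k : ℕ) : (k : ℝ) ≤
      ∑ i ∈ range (s k).1, min (‖(s k).2 (2 * i)‖ ^ p) (‖(s k).2 (2 * i + 1)‖ ^ p) := by
    induction k with
    | zero => simp [hs0]
    | succ k ih =>
      rw [hs]
      push_cast
      exact (add_le_add_left ih 1).trans (hmin k (s k))
  refine ⟨A, fun k => (s k).1, hk, fun k => ?_, fun k => ?_, fun k => ?_⟩
  · refine (sum_congr rfl fun n hn => ?_).trans_le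
      ((hsumq k).trans (sub_le_self _ (by positivity)))
    rw [hA k n (mem_range.1 hn)]
  · refine (hsummin k).trans_eq (sum_congr rfl fun i hi => ?_)
    have : i < (s k).1 := mem_range.1 hi
    rw [hA k _ (by omega), hA k _ (by omega)]
  · obtain ⟨r, h0, h1, h2, h3, h4⟩ := hr k (s k)
    refine ⟨r, h0, h1, h2, by simpa only [hs] using h3, fun z hz => (h4 z hz).trans_eq ?_⟩
    beta_reduce
    rw [hs]
    congr 1
    refine sum_congr rfl fun n hn => ?_
    rw [hA (k + 1) n (by rw [hs]; exact mem_range.1 hn), hs]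

/-! ### The analytic function and its growth -/

theorem hasFPowerSeriesOnBall_tsum {A : ℕ → ℂ} (hA : ∀ n, ‖A n‖ ≤ 1) :
    HasFPowerSeriesOnBall (fun z => ∑' n, A n * z ^ n)
      (FormalMultilinearSeries.ofScalars ℂ A) 0 1 := by
  have hrad : (1 : ℝ≥0∞) ≤ (FormalMultilinearSeries.ofScalars ℂ A).radius := by
    have := (FormalMultilinearSeries.ofScalars ℂ A).le_radius_of_bound 1 (r := 1)
      fun n => by simpa using hA n
    simpa using this
  have h := ((FormalMultilinearSeries.ofScalars ℂ A).hasFPowerSeriesOnBall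
    (zero_lt_one.trans_le hrad)).mono zero_lt_one hrad
  have e : (fun z => ∑' n, A n * z ^ n) = (FormalMultilinearSeries.ofScalars ℂ A).sum := by
    have := FormalMultilinearSeries.ofScalarsSum_eq_tsum (E := ℂ) A
    rw [FormalMultilinearSeries.ofScalarsSum] at this
    simpa using this.symm
  rwa [e]

theorem taylorCoeff_eq_of_hasFPowerSeriesAt {f : ℂ → ℂ} {A : ℕ → ℂ}
    (h : HasFPowerSeriesAt f (FormalMultilinearSeries.ofScalars ℂ A) 0) : taylorCoeff f = A :=
  FormalMultilinearSeries.ofScalars_series_injective ℂ ℂ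
    (h.analyticAt.hasFPowerSeriesAt.eq_formalMultilinearSeries h)

theorem sub_one_le_norm_tsum {A : ℕ → ℂ} (hA : ∀ n, ‖A n‖ ≤ 1) {N : ℕ} {r S : ℝ} {z : ℂ}
    (hr1 : r < 1) (hz : ‖z‖ = r) (hN : r ^ N / (1 - r) ≤ 1)
    (hS : S ≤ ‖∑ n ∈ range N, A n * z ^ n‖) : S - 1 ≤ ‖∑' n, A n * z ^ n‖ := by
  have hr0 : 0 ≤ r := hz ▸ norm_nonneg z
  have hle (n : ℕ) : ‖A n * z ^ n‖ ≤ r ^ n := by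
    rw [norm_mul, norm_pow, hz]
    exact mul_le_of_le_one_left (by positivity) (hA n)
  have hgeo := summable_geometric_of_lt_one hr0 hr1
  have hsum : Summable fun n => A n * z ^ n := .of_norm_bounded hgeo hle
  have htail : ‖∑' n, A (n + N) * z ^ (n + N)‖ ≤ 1 := by
    refine le_trans (tsum_of_norm_bounded (g := fun n => r ^ N * r ^ n)
      ((hasSum_geometric_of_lt_one hr0 hr1).mul_left _) fun n => ?_) hN
    rw [← pow_add, add_comm N]
    exact hle _
  rw [← hsum.sum_add_tsum_nat_add N]
  refine le_trans ?_ (norm_sub_le_norm_add _ _)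
  linarith

theorem limsup_iInf_enorm_eq_top {f : ℂ → ℂ}
    (h : ∀ k : ℕ, ∃ r : ℝ, 1 - 1 / ((k : ℝ) + 1) < r ∧ r < 1 ∧
      ∀ z : ℂ, ‖z‖ = r → (k : ℝ) - 1 ≤ ‖f z‖) :
    limsup (fun r : ℝ => ⨅ z ∈ Metric.sphere (0 : ℂ) r, ‖f z‖ₑ) (𝓝[<] (1 : ℝ)) = ∞ := by
  choose r hr hr1 hf using h
  have hlim : Tendsto r atTop (𝓝[<] 1) := by
    refine tendsto_nhdsWithin_iff.2 ⟨?_, .of_forall hr1⟩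
    refine tendsto_of_tendsto_of_tendsto_of_le_of_le ?_ tendsto_const_nhds (fun k => (hr k).le)
      fun k => (hr1 k).le
    simpa using (tendsto_one_div_add_atTop_nhds_zero_nat (𝕜 := ℝ)).const_sub 1
  refine ENNReal.eq_top_of_forall_nnreal_le fun C => ?_
  refine le_limsup_of_frequently_le (hlim.frequently (Eventually.frequently ?_))
  filter_upwards [eventually_ge_atTop ⌈(C : ℝ) + 1⌉₊] with k hk
  refine le_iInf₂ fun z hz => ?_
  have hkC : (C : ℝ) + 1 ≤ k := Nat.ceil_le.1 hk
  have := hf k z (by simpa using hz)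
  rw [enorm_eq_nnnorm, ENNReal.coe_le_coe, ← NNReal.coe_le_coe, coe_nnnorm]
  linarith

theorem theorem3 (p q : ℝ) (hp : 2 ≤ p) (hpq : p < q) :
    ∃ f : ℂ → ℂ, StronglyAnnular f ∧
      Memℓp (taylorCoeff f) (ENNReal.ofReal q) ∧
      taylorCoeff f ∉ tildeLp p := by
  obtain ⟨A, M, hM, hq, hmin, hr⟩ := exists_coeff hp hpq
  have hq0 : 0 < q := by linarith
  have hsum (N : ℕ) : ∑ n ∈ range N, ‖A n‖ ^ q ≤ 1 := by
    have := hM N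
    refine (sum_le_sum_of_subset_of_nonneg (range_subset_range.2 (by omega))
      fun _ _ _ => by positivity).trans (hq N)
  have hA (n : ℕ) : ‖A n‖ ≤ 1 := by
    have h1 : ‖A n‖ ^ q ≤ 1 := (single_le_sum (f := fun n => ‖A n‖ ^ q)
      (fun _ _ => by positivity) (self_mem_range_succ n)).trans (hsum (n + 1))
    by_contra! hlt
    exact h1.not_gt (Real.one_lt_rpow hlt hq0)
  have hps := hasFPowerSeriesOnBall_tsum hA
  have hcoeff := taylorCoeff_eq_of_hasFPowerSeriesAt hps.hasFPowerSeriesAt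
  refine ⟨fun z => ∑' n, A n * z ^ n, ⟨?_, limsup_iInf_enorm_eq_top fun k => ?_⟩, ?_, ?_⟩
  · have := hps.analyticOnNhd
    rwa [← ENNReal.ofReal_one, Metric.eball_ofReal] at this
  · obtain ⟨r, -, h1, h2, h3, h4⟩ := hr k
    exact ⟨r, h1, h2, fun z hz => sub_one_le_norm_tsum hA h2 hz h3 (h4 z hz)⟩
  · rw [hcoeff]
    refine memℓp_gen ?_
    rw [ENNReal.toReal_ofReal hq0.le]
    exact summable_of_sum_range_le (fun _ => by positivity) hsum
  · rw [hcoeff]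
    intro (h : Summable _)
    obtain ⟨k, hk⟩ := exists_nat_gt (∑' i, min (‖A (2 * i)‖ ^ p) (‖A (2 * i + 1)‖ ^ p))
    exact (hk.trans_le (hmin k)).not_ge (h.sum_le_tsum _ fun _ _ => by positivity)
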